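/- Let $\delta>0$, $\kappa\ge 5\cdot 10^4\,\delta$ and $N>0$ be real numbers. For points of a metric space write $|x-y|$ for the distance and $(y,z)_x=\frac12\left(|y-x|+|z-x|-|y-z|\right)$ for the Gromov product. Let $X$ be a length space (the distance between two points is the infimum of the lengths of the paths joining them) that is $\delta$-hyperbolic, that is, $(x,z)_t\ge\min\{(x,y)_t,(y,z)_t\}-\delta$ for all $x,y,z,t\in X$. Let a group $G$ act by isometries on $X$, and assume that the action is $(N,\kappa)$-acylindrical: for all $x,y\in X$ with $|x-y|\ge\kappa$ there are at most $N$ elements $g\in G$ such that $|x-gx|\le 100\delta$ and $|y-gy|\le 100\delta$. For a finite set $U\subset G$ let $\lambda(U)=\inf_{x\in X}\max_{u\in U}|ux-x|$ be its $\ell^\infty$-energy. For $p\in X$ and $\alpha>0$, call a finite set $W\subset G$ *$\alpha$-strongly reduced at $p$* if - $(w_1^{-1}p,w_2p)_p\le\alpha$ for all $w_1,w_2\in W$, - $|wp-p|>2\alpha+300\delta$ for all $w\in W$, and - $(w_1p,w_2p)_p<\min\{|w_1p-p|,|w_2p-p|\}-\alpha-150\delta$ for all distinct $w_1,w_2\in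 W$. Then for every finite $U\subset G$ with $\lambda(U)>100\kappa$, one of the following holds: 1. $|U|\le 400\,\kappa N/\delta$; 2. there are a point $p\in X$, an element $v\in U$, a subset $W\subset Uv$ and a number $0<\alpha\le 25\kappa$ such that $W$ is $\alpha$-strongly reduced at $p$ and $$|W|\ \ge\ \frac{1}{10^6N}\,\frac{\delta}{\lambda(U)}\,|U|.$$ Moreover every finite subset $W\subset G$ that is $\alpha$-strongly reduced at some $p\in X$ for some $\alpha>0$ (in particular the set $W$ in alternative 2) freely generates a free sub-semigroup of $G$: the canonical map from the free monoid on $W$ to $G$ is injective. -/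

import Mathlib

noncomputable section

namespace HypGroup

/-- A length space: the distance between any two points is the infimum of the lengths of the
continuous paths joining them. -/
def IsLengthSpace (X : Type*) [MetricSpace X] : Prop :=
  ∀ x y : X, edist x y = ⨅ γ : Path x y, eVariationOn (fun t : unitInterval => γ t) Set.univ

/-- The Gromov product `(y, z)_x` of `y` and `z` at `x`. -/
def gromovProduct {X : Type*} [MetricSpace X] (y z x : X) : ℝ :=
  (dist y x + dist z x - dist y z) / 2

/-- `δ`-hyperbolicity, through the four point inequality. -/
def IsHyperbolic (X : Type*) [MetricSpace X] (δ : ℝ) : Prop :=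
  ∀ x y z t : X,
    min (gromovProduct x y t) (gromovProduct y z t) - δ ≤ gromovProduct x z t

/-- The action of `G` on the `δ`-hyperbolic space `X` is `(N, κ)`-acylindrical: whenever
`x` and `y` are at distance at least `κ`, at most `N` elements of `G` (in particular only finitely
many) move both `x` and `y` by at most `100 δ`. -/
def IsAcylindrical (G X : Type*) [Group G] [MetricSpace X] [MulAction G X] (δ N κ : ℝ) : Prop :=
  ∀ x y : X, κ ≤ dist x y →
    {g : G | dist x (g • x) ≤ 100 * δ ∧ dist y (g • y) ≤ 100 * δ}.Finite ∧
    ({g : G | dist x (g • x) ≤ 100 * δ ∧ dist y (g • y) ≤ 100 * δ}.ncard : ℝ) ≤ N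

/-- The `ℓ^∞`-energy `λ(U, x)` at the point `x` of a finite set `U`. -/
def energyAt {G X : Type*} [Group G] [MetricSpace X] [MulAction G X] (U : Finset G) (x : X) : ℝ :=
  ⨆ u : U, dist ((u : G) • x) x

/-- The `ℓ^∞`-energy `λ(U)` of a finite set `U` acting on `X`. -/
def energy {G : Type*} (X : Type*) [Group G] [MetricSpace X] [MulAction G X] (U : Finset G) : ℝ :=
  ⨅ x : X, energyAt U x

/-- `U` is `α`-reduced at `p`. -/
structure IsReduced {G X : Type*} [Group G] [MetricSpace X] [MulAction G X]
    (δ α : ℝ) (p : X) (U : Finset G) : Prop where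
  pos : 0 < α
  product_le : ∀ u₁ ∈ U, ∀ u₂ ∈ U, gromovProduct (u₁⁻¹ • p) (u₂ • p) p ≤ α
  lt_dist : ∀ u ∈ U, 2 * α + 300 * δ < dist (u • p) p

/-- `U` is `α`-strongly reduced at `p`. -/
structure IsStronglyReduced {G X : Type*} [Group G] [MetricSpace X] [MulAction G X]
    (δ α : ℝ) (p : X) (U : Finset G) : Prop extends IsReduced δ α p U where
  product_lt : ∀ u₁ ∈ U, ∀ u₂ ∈ U, u₁ ≠ u₂ →
    gromovProduct (u₁ • p) (u₂ • p) p <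
      min (dist (u₁ • p) p) (dist (u₂ • p) p) - α - 150 * δ

/-- `U` freely generates a free sub-semigroup of `G`: distinct words over `U` represent distinct
elements of `G` (the empty word representing `1`). -/
def FreelyGenerates {G : Type*} [Group G] (U : Finset G) : Prop :=
  Function.Injective (FreeMonoid.lift (fun u : U => (u : G)))

end HypGroup

end

/-! If `p, u p, u v p` does not backtrack by more than `D`, its second half is a translate by `u` of
`[p, v p]` that follows `[p, u v p]` from distance `D` on. When several products `u v p` have about
the same length and a long common beginning, two points of `[p, v p]` at distance at least `κ` have
all their translates close together, so acylindricity allows at most `N` such `u`. Sorting by length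
costs a factor of order `λ(U) / δ`, separating endpoints a factor `N` (`exists_isStronglyReduced`).

It remains to find `p` and `v` without cancellation. Take `p` almost minimizing the total
displacement of `U`. If many elements move `p` little, any `v` of large displacement works:
cancellation is `O(κ)`, apart from few elements that acylindricity controls. Otherwise most
displacements are long, and if every `v` cancelled with most of `U`, many `u p` and `u⁻¹ p` would
lie in one direction, so moving `p` that way would lower the total displacement
(`exists_compatible`).

Freeness is a local-to-global argument: a word's path follows its first letter. -/

namespace HypGroup

/-! ### Fellow travelling in hyperbolic length spaces -/

section Metric

variable {X : Type*} [MetricSpace X]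

theorem gromovProduct_comm (y z x : X) : gromovProduct y z x = gromovProduct z y x := by
  unfold gromovProduct
  rw [dist_comm y z]
  ring

/-- A length space contains approximate intermediate points. -/
theorem IsLengthSpace.exists_between (hX : IsLengthSpace X) (x y : X) {s ε : ℝ} (hs : 0 ≤ s)
    (hsd : s ≤ dist x y) (hε : 0 < ε) :
    ∃ z, dist x z = s ∧ dist z y ≤ dist x y - s + ε := by
  have h1 : (⨅ γ : Path x y, eVariationOn (fun t : unitInterval => γ t) Set.univ) <
      ENNReal.ofReal (dist x y + ε) := by
    rw [← hX x y, edist_dist]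
    exact (ENNReal.ofReal_lt_ofReal_iff (by positivity)).2 (by linarith)
  obtain ⟨γ, hγ⟩ := iInf_lt_iff.1 h1
  have hc : Continuous fun t : unitInterval => dist x (γ t) := by fun_prop
  obtain ⟨t, ht⟩ := mem_range_of_exists_le_of_exists_ge (c := s) hc
    ⟨0, by simpa using hs⟩ ⟨1, by simpa using hsd⟩
  refine ⟨γ t, ht, ?_⟩
  have h2 := eVariationOn.add_le_union (fun t : unitInterval => γ t) (s := Set.Iic t)
    (t := Set.Ici t) (fun a ha b hb => le_trans ha hb)
  have h3 := eVariationOn.edist_le (fun t : unitInterval => γ t) (s := Set.Iic t)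
    (x := 0) (y := t) unitInterval.nonneg' (le_refl t)
  have h4 := eVariationOn.edist_le (fun t : unitInterval => γ t) (s := Set.Ici t)
    (x := t) (y := 1) (le_refl t) unitInterval.le_one'
  have h5 : edist x (γ t) + edist (γ t) y < ENNReal.ofReal (dist x y + ε) := by
    refine lt_of_le_of_lt ?_ hγ
    rw [Set.Iic_union_Ici] at h2
    refine le_trans ?_ h2
    simpa using add_le_add h3 h4
  rw [edist_dist, edist_dist, ← ENNReal.ofReal_add dist_nonneg dist_nonneg,
    ENNReal.ofReal_lt_ofReal_iff (by positivity)] at h5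
  have ht' : dist x (γ t) = s := ht
  linarith

/-- The four point inequality in terms of distances. -/
theorem IsHyperbolic.dist_add_dist_le {δ : ℝ} (h : IsHyperbolic X δ) (x y z t : X) :
    dist x z + dist y t ≤ max (dist x y + dist z t) (dist y z + dist x t) + 2 * δ := by
  have := h x y z t
  unfold gromovProduct at this
  rcases le_total (dist x y + dist z t) (dist y z + dist x t) with h1 | h1
  · rw [max_eq_right h1]
    rcases min_le_iff.1 (le_refl (min ((dist x t + dist y t - dist x y) / 2)
      ((dist y t + dist z t - dist y z) / 2))) with h2 | h2 <;>
    rw [min_eq_right (by linarith)] at this <;> linarith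
  · rw [max_eq_left h1]
    rw [min_eq_left (by linarith)] at this
    linarith

theorem IsHyperbolic.le_gromovProduct {δ c : ℝ} (h : IsHyperbolic X δ) {x y z t : X}
    (h1 : c ≤ gromovProduct x y t) (h2 : c ≤ gromovProduct y z t) :
    c - δ ≤ gromovProduct x z t :=
  le_trans (sub_le_sub_right (le_min h1 h2) δ) (h x y z t)

/-- A point of the segment `[a, w]` far enough from `a` is close to the segment `[p, w]`. -/
theorem IsHyperbolic.dist_le_of_between {δ ℓ τ : ℝ} (h : IsHyperbolic X δ) (hδ : 0 < δ)
    {p a w ζ : X} (haw : dist a w = ℓ) (haζ : dist a ζ = τ) (hζw : dist ζ w ≤ ℓ - τ + δ)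
    (hp : gromovProduct p w a ≤ τ) :
    dist p ζ ≤ dist w p - ℓ + τ + 3 * δ ∧ dist w p - ℓ + τ - δ ≤ gromovProduct ζ w p := by
  constructor
  · have h1 := h.dist_add_dist_le p a ζ w
    unfold gromovProduct at hp
    rw [dist_comm w a, dist_comm p w] at hp
    rw [dist_comm p w] at h1
    rcases max_cases (dist p a + dist ζ w) (dist a ζ + dist w p) with h2 | h2 <;> linarith
  · unfold gromovProduct
    have := dist_triangle w ζ p
    rw [dist_comm w ζ] at this
    linarith

/-- Two segments ending at `w₁` and `w₂` that fellow travel with `[p, w₁]` and `[p, w₂]` pass close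
to each other, as long as `[p, w₁]` and `[p, w₂]` do. -/
theorem IsHyperbolic.dist_le_of_fellow {δ ℓ τ a : ℝ} (h : IsHyperbolic X δ) (hδ : 0 < δ)
    {p a₁ w₁ ζ₁ a₂ w₂ ζ₂ : X}
    (h₁ : dist a₁ w₁ = ℓ) (k₁ : dist a₁ ζ₁ = τ) (l₁ : dist ζ₁ w₁ ≤ ℓ - τ + δ)
    (m₁ : gromovProduct p w₁ a₁ ≤ τ) (b₁ : a ≤ dist w₁ p) (c₁ : dist w₁ p ≤ a + δ)
    (h₂ : dist a₂ w₂ = ℓ) (k₂ : dist a₂ ζ₂ = τ) (l₂ : dist ζ₂ w₂ ≤ ℓ - τ + δ)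
    (m₂ : gromovProduct p w₂ a₂ ≤ τ) (b₂ : a ≤ dist w₂ p) (c₂ : dist w₂ p ≤ a + δ)
    (hw : a - ℓ + τ ≤ gromovProduct w₁ w₂ p) :
    dist ζ₁ ζ₂ ≤ 100 * δ := by
  obtain ⟨d₁, e₁⟩ := h.dist_le_of_between hδ h₁ k₁ l₁ m₁
  obtain ⟨d₂, e₂⟩ := h.dist_le_of_between hδ h₂ k₂ l₂ m₂
  rw [gromovProduct_comm] at e₂
  -- The chain `ζ₁, w₁, w₂, ζ₂` costs `2 δ`; the resulting bound is `14 δ`, well within `100 δ`.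
  have f₁ : a - ℓ + τ - δ - δ ≤ gromovProduct ζ₁ w₂ p :=
    h.le_gromovProduct (y := w₁) (by linarith) (by linarith)
  have f₂ : a - ℓ + τ - δ - δ - δ ≤ gromovProduct ζ₁ ζ₂ p :=
    h.le_gromovProduct (y := w₂) (by linarith) (by linarith)
  unfold gromovProduct at f₂
  rw [dist_comm ζ₁ p, dist_comm ζ₂ p] at f₂
  linarith

/-- Since `[p, x]` follows `[p, y]` for a length at least `s`, it passes near `q`: moving from `p`
to `q` gains `s`. -/
theorem IsHyperbolic.dist_le_sub {δ s : ℝ} (h : IsHyperbolic X δ) (hδ : 0 < δ) {p q x y : X}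
    (hq : dist p q = s) (hqy : dist q y ≤ dist p y - s + δ) (hx : s ≤ gromovProduct x y p) :
    dist x q ≤ dist x p - s + 4 * δ := by
  have h1 : s - δ ≤ gromovProduct y q p := by
    unfold gromovProduct
    rw [dist_comm y p, dist_comm q p, dist_comm y q]
    linarith
  have h2 := h.le_gromovProduct (c := s - δ) (by linarith) h1 (x := x)
  unfold gromovProduct at h2
  rw [dist_comm q p] at h2
  linarith

end Metric

/-! ### Independent sets and pigeonhole -/

section Combinatorics

/-- A symmetric reflexive relation of degree at most `N` has an independent set containing a
proportion at least `1 / N` of the elements. -/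
theorem exists_independent_subset {ι : Type*} (R : ι → ι → Prop)
    (hs : ∀ a b, R a b → R b a) {N : ℝ} (T : Finset ι) (hr : ∀ a ∈ T, R a a)
    (hN : ∀ a ∈ T, ∀ T' ⊆ T, (∀ b ∈ T', R a b) → (T'.card : ℝ) ≤ N) :
    ∃ W ⊆ T, (∀ a ∈ W, ∀ b ∈ W, a ≠ b → ¬ R a b) ∧ (T.card : ℝ) ≤ N * W.card := by
  classical
  induction T using Finset.strongInduction with
  | H T ih =>
    rcases T.eq_empty_or_nonempty with rfl | ⟨a, ha⟩
    · exact ⟨∅, by simp⟩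
    -- Greedy choice: keep `a` and discard its at most `N` neighbours, `a` included.
    have hsub : T.filter (fun b => ¬ R a b) ⊂ T :=
      Finset.filter_ssubset.2 ⟨a, ha, by simpa using hr a ha⟩
    obtain ⟨W, hWT, hW, hc⟩ := ih _ hsub (fun b hb => hr b (hsub.1 hb))
      (fun b hb T' hT' => hN b (hsub.1 hb) T' (hT'.trans hsub.1))
    have hRW : ∀ b ∈ W, ¬ R a b := fun b hb => (Finset.mem_filter.1 (hWT hb)).2
    have haW : a ∉ W := fun h => hRW a h (hr a ha)
    refine ⟨insert a W, Finset.insert_subset ha (hWT.trans hsub.1), ?_, ?_⟩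
    · intro b hb c hc hbc
      rcases Finset.mem_insert.1 hb with rfl | hb' <;> rcases Finset.mem_insert.1 hc with rfl | hc'
      · exact absurd rfl hbc
      · exact hRW c hc'
      · exact fun h => hRW b hb' (hs _ _ h)
      · exact hW b hb' c hc' hbc
    · have h1 := hN a ha (T.filter (R a)) (Finset.filter_subset _ _)
        (fun b hb => (Finset.mem_filter.1 hb).2)
      have h2 : ((T.filter (R a)).card : ℝ) + (T.filter (fun b => ¬ R a b)).card = T.card := by
        exact_mod_cast Finset.card_filter_add_card_filter_not (s := T) (R a)
      rw [Finset.card_insert_of_notMem haW]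
      push_cast
      linarith

/-- Pigeonhole principle for intervals of length `δ`. -/
theorem exists_interval_card {ι : Type*} (T : Finset ι) (f : ι → ℝ) {lo M δ : ℝ} (hδ : 0 < δ)
    (hM : 0 ≤ M) (hf : ∀ u ∈ T, lo ≤ f u ∧ f u ≤ lo + M) :
    ∃ a, ∃ T' ⊆ T, (∀ u ∈ T', a ≤ f u ∧ f u ≤ a + δ) ∧
      (T.card : ℝ) ≤ (M / δ + 1) * T'.card := by
  classical
  have hmaps : ∀ u ∈ T, ⌊(f u - lo) / δ⌋₊ ∈ Finset.range (⌊M / δ⌋₊ + 1) := by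
    intro u hu
    rw [Finset.mem_range, Nat.lt_succ_iff]
    apply Nat.floor_le_floor
    have := (hf u hu).2
    gcongr
    linarith
  have hpos : (0 : ℝ) < ((⌊M / δ⌋₊ + 1 : ℕ) : ℝ) := by positivity
  obtain ⟨k, -, hk⟩ := Finset.exists_le_card_fiber_of_nsmul_le_card_of_maps_to
    (b := (T.card : ℝ) / ((⌊M / δ⌋₊ + 1 : ℕ) : ℝ)) hmaps ⟨0, by simp⟩
    (by rw [Finset.card_range, nsmul_eq_mul, mul_div_cancel₀ _ hpos.ne'])
  refine ⟨lo + k * δ, T.filter (fun u => ⌊(f u - lo) / δ⌋₊ = k), Finset.filter_subset _ _, ?_, ?_⟩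
  rotate_left
  · rw [div_le_iff₀ hpos, mul_comm] at hk
    refine hk.trans ?_
    gcongr
    push_cast
    gcongr
    exact Nat.floor_le (by positivity)
  · intro u hu
    obtain ⟨huT, rfl⟩ := Finset.mem_filter.1 hu
    have h0 : 0 ≤ (f u - lo) / δ := div_nonneg (by linarith [(hf u huT).1]) hδ.le
    have h1 := Nat.floor_le h0
    have h2 := (Nat.lt_floor_add_one ((f u - lo) / δ)).le
    rw [le_div_iff₀ hδ] at h1
    rw [div_le_iff₀ hδ] at h2
    constructor <;> linarith

end Combinatorics

/-! ### Counting by acylindricity; free semigroups -/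

section Action

variable {G X : Type*} [Group G] [MetricSpace X] [MulAction G X] [IsIsometricSMul G X]

theorem gromovProduct_smul (g : G) (y z x : X) :
    gromovProduct (g • y) (g • z) (g • x) = gromovProduct y z x := by
  simp [gromovProduct, dist_smul]

theorem dist_inv_smul_self (g : G) (x : X) : dist (g⁻¹ • x) x = dist (g • x) x := by
  rw [← dist_smul g, smul_inv_smul, dist_comm]

/-- `(u p, u v p)_p` and `(u⁻¹ p, v p)_p` add up to `|u p - p|`. -/
theorem gromovProduct_mul_smul_add (u v : G) (p : X) :
    gromovProduct (u • p) ((u * v) • p) p + gromovProduct (u⁻¹ • p) (v • p) p =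
      dist (u • p) p := by
  rw [← gromovProduct_smul u (u⁻¹ • p), smul_inv_smul, smul_smul]
  unfold gromovProduct
  rw [dist_comm p (u • p), dist_comm p, dist_comm ((u * v) • p) (u • p)]
  ring

/-- At most `N` elements `u` have their paths from `p` to `u v p` close to each other along their
last parts. -/
theorem IsAcylindrical.card_le {δ κ N : ℝ} (hacyl : IsAcylindrical G X δ N κ) (hδ : 0 < δ)
    (hX : IsLengthSpace X) (h : IsHyperbolic X δ) {p : X} {v : G} {D τ a : ℝ} (hD : 0 ≤ D)
    (hκ : 0 ≤ κ) (hτ : D + κ ≤ τ) (hτv : τ ≤ dist (v • p) p) (T : Finset G) {u₀ : G} (hu₀ : u₀ ∈ T)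
    (hTD : ∀ u ∈ T, gromovProduct (u⁻¹ • p) (v • p) p ≤ D)
    (hTa : ∀ u ∈ T, a ≤ dist ((u * v) • p) p ∧ dist ((u * v) • p) p ≤ a + δ) (T' : Finset G)
    (hT' : T' ⊆ T)
    (hT : ∀ u ∈ T', a - dist (v • p) p + τ ≤ gromovProduct ((u₀ * v) • p) ((u * v) • p) p) :
    (T'.card : ℝ) ≤ N := by
  classical
  obtain ⟨z, hz, hz'⟩ := hX.exists_between p (v • p) hD
    (by rw [dist_comm p]; linarith) hδ
  obtain ⟨y, hy, hy'⟩ := hX.exists_between p (v • p) (s := τ) (by linarith)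
    (by rw [dist_comm p]; linarith) hδ
  have hzy : κ ≤ dist z y := by
    have := dist_triangle p z y
    linarith
  obtain ⟨hfin, hcard⟩ := hacyl z y hzy
  refine le_trans ?_ hcard
  -- Backtracking ends before `s ≥ D`, so `u x` is close to `[p, u v p]`; `s ≤ τ` keeps it on the
  -- part shared with `[p, u₀ v p]`.
  have key : ∀ x s, dist p x = s → dist x (v • p) ≤ dist p (v • p) - s + δ → D ≤ s → s ≤ τ →
      ∀ u ∈ T', dist x ((u₀⁻¹ * u) • x) ≤ 100 * δ := by
    intro x s hx hx' hs hs' u hu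
    have hm : ∀ g ∈ T, gromovProduct p ((g * v) • p) (g • p) ≤ s := fun g hg => by
      rw [← gromovProduct_smul g⁻¹]
      simpa [mul_smul] using (hTD g hg).trans hs
    have := h.dist_le_of_fellow (p := p) (ℓ := dist (v • p) p) (τ := s) (a := a) hδ
      (a₁ := u₀ • p) (w₁ := (u₀ * v) • p) (ζ₁ := u₀ • x) (a₂ := u • p) (w₂ := (u * v) • p)
      (ζ₂ := u • x)
      (by rw [mul_smul, dist_smul, dist_comm]) (by rw [dist_smul, hx])
      (by rw [mul_smul, dist_smul, dist_comm _ p]; exact hx') (hm u₀ hu₀)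
      (hTa u₀ hu₀).1 (hTa u₀ hu₀).2
      (by rw [mul_smul, dist_smul, dist_comm]) (by rw [dist_smul, hx])
      (by rw [mul_smul, dist_smul, dist_comm _ p]; exact hx') (hm u (hT' hu))
      (hTa u (hT' hu)).1 (hTa u (hT' hu)).2 (by linarith [hT u hu])
    rwa [← dist_smul u₀, smul_smul, mul_inv_cancel_left]
  rw [← Set.ncard_coe_finset, ← Set.ncard_image_of_injective (T' : Set G)
    (mul_right_injective u₀⁻¹)]
  refine Nat.cast_le.2 ?_
  refine Set.ncard_le_ncard ?_ hfin
  rintro _ ⟨u, hu, rfl⟩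
  exact ⟨key z D hz hz' le_rfl (by linarith) u hu,
    key y τ hy hy' (by linarith) le_rfl u hu⟩

/-- Extraction of a strongly reduced set from a set of products `u v` without cancellation. -/
theorem exists_isStronglyReduced {δ κ N : ℝ} (hacyl : IsAcylindrical G X δ N κ) (hδ : 0 < δ)
    (hκ : 0 ≤ κ)
    (hX : IsLengthSpace X) (h : IsHyperbolic X δ) {p : X} {v : G} {D α lo M : ℝ} (hD : 0 ≤ D)
    (hα : 0 < α) (hM : 0 ≤ M) (hlo : 2 * α + 300 * δ < lo)
    (hv : D + κ + α + 150 * δ ≤ dist (v • p) p) (T : Finset G)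
    (hTD : ∀ u ∈ T, gromovProduct (u⁻¹ • p) (v • p) p ≤ D)
    (hTM : ∀ u ∈ T, lo ≤ dist ((u * v) • p) p ∧ dist ((u * v) • p) p ≤ lo + M)
    (hTα : ∀ u₁ ∈ T, ∀ u₂ ∈ T,
      gromovProduct ((u₁ * v)⁻¹ • p) ((u₂ * v) • p) p ≤ α) :
    ∃ W : Finset G, (W : Set G) ⊆ (fun u : G => u * v) '' (T : Set G) ∧
      IsStronglyReduced δ α p W ∧ (T.card : ℝ) ≤ (M / δ + 1) * (N * W.card) := by
  classical
  obtain ⟨a, T', hT'T, hT', hc⟩ := exists_interval_card T (fun u => dist ((u * v) • p) p) hδ hM hTM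
  -- The relation is the failure of the last condition of strong reducedness;
  -- `IsAcylindrical.card_le` bounds its degree by `N`.
  obtain ⟨W, hWT, hW, hcW⟩ := exists_independent_subset
    (fun u₁ u₂ : G => min (dist ((u₁ * v) • p) p) (dist ((u₂ * v) • p) p) - α - 150 * δ ≤
      gromovProduct ((u₁ * v) • p) ((u₂ * v) • p) p)
    (fun u₁ u₂ hu => by rwa [min_comm, gromovProduct_comm] at hu) (N := N) T'
    (fun u _ => by
      have : gromovProduct ((u * v) • p) ((u * v) • p) p = dist ((u * v) • p) p := by
        simp [gromovProduct]
      rw [this, min_self]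
      linarith)
    (fun u hu T₁ hT₁ hR => by
      refine hacyl.card_le hδ hX h hD hκ (τ := dist (v • p) p - α - 150 * δ) (a := a) (by linarith)
        (by linarith) T' hu (fun g hg => hTD g (hT'T hg)) hT' T₁ hT₁ fun g hg => ?_
      have h1 := hR g hg
      have h2 := le_min (hT' u hu).1 (hT' g (hT₁ hg)).1
      linarith)
  refine ⟨W.image (· * v), ?_, ⟨⟨hα, ?_, ?_⟩, ?_⟩, ?_⟩
  · rw [Finset.coe_image]
    exact Set.image_mono (Finset.coe_subset.2 (hWT.trans hT'T))
  · simp only [Finset.forall_mem_image]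
    exact fun u₁ h₁ u₂ h₂ => hTα u₁ (hT'T (hWT h₁)) u₂ (hT'T (hWT h₂))
  · simp only [Finset.forall_mem_image]
    exact fun u hu => hlo.trans_le (hTM u (hT'T (hWT hu))).1
  · simp only [Finset.forall_mem_image]
    intro u₁ h₁ u₂ h₂ hne
    exact not_le.1 (hW u₁ h₁ u₂ h₂ (fun h => hne (by rw [h])))
  · rw [Finset.card_image_of_injective _ (mul_left_injective v)]
    refine hc.trans ?_
    gcongr

/-- Along a word over a reduced set, the path of partial products does not backtrack. -/
theorem IsReduced.dist_prod {δ α : ℝ} (h : IsHyperbolic X δ) (hδ : 0 < δ) {p : X} {U : Finset G}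
    (hU : IsReduced δ α p U) (l : List G) (hl : ∀ u ∈ l, u ∈ U) (w : G) (hw : w ∈ U) :
    gromovProduct (w⁻¹ • p) (l.prod • p) p ≤ α + δ ∧ dist (w • p) p - α - δ ≤
      gromovProduct (w • p) ((w * l.prod) • p) p := by
  have main : gromovProduct (w⁻¹ • p) (l.prod • p) p ≤ α + δ := by
    induction l generalizing w with
    | nil =>
      have : gromovProduct (w⁻¹ • p) ((1 : G) • p) p = 0 := by simp [gromovProduct]
      rw [List.prod_nil, this]
      linarith [hU.pos]
    | cons u l ih =>
      have hu : u ∈ U := hl u (by simp)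
      -- By induction the tail follows `u p` beyond `α + δ`, so only `(w⁻¹ p, u p)_p ≤ α` matters
      -- and the error `δ` does not accumulate.
      have h1 := ih (fun g hg => hl g (by simp [hg])) u hu
      have h2 := gromovProduct_mul_smul_add u l.prod p
      have h3 := hU.product_le w hw u hu
      have h4 := hU.lt_dist u hu
      have h5 := h (w⁻¹ • p) ((u * l.prod) • p) (u • p) p
      rw [List.prod_cons]
      by_contra! h6
      rw [gromovProduct_comm ((u * l.prod) • p)] at h5
      have h7 : α + δ < gromovProduct (u • p) ((u * l.prod) • p) p := by linarith [hU.pos]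
      linarith [lt_min h6 h7]
  exact ⟨main, by linarith [gromovProduct_mul_smul_add w l.prod p]⟩

/-- Strongly reduced sets freely generate free semigroups. -/
theorem IsStronglyReduced.freelyGenerates {δ α : ℝ} (h : IsHyperbolic X δ) (hδ : 0 < δ) {p : X}
    {U : Finset G} (hU : IsStronglyReduced δ α p U) : FreelyGenerates U := by
  have hne : ∀ (w : G) (l : List G), w ∈ U → (∀ u ∈ l, u ∈ U) → w * l.prod ≠ 1 := by
    intro w l hw hl h1
    have h2 := (hU.dist_prod h hδ l hl w hw).2
    have h3 : gromovProduct (w • p) ((w * l.prod) • p) p = 0 := by simp [h1, gromovProduct]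
    have := hU.lt_dist w hw
    linarith [hU.pos]
  have key : ∀ l₁ l₂ : List U, (l₁.map Subtype.val).prod = (l₂.map Subtype.val).prod → l₁ = l₂ := by
    have hmem : ∀ l : List U, ∀ u ∈ l.map Subtype.val, u ∈ U := by
      intro l u hu
      obtain ⟨a, -, rfl⟩ := List.mem_map.1 hu
      exact a.2
    intro l₁
    induction l₁ with
    | nil =>
      rintro (_ | ⟨b, l₂⟩) hl
      · rfl
      · rw [List.map_cons, List.prod_cons] at hl
        exact absurd hl.symm (hne b _ b.2 (hmem l₂))
    | cons a l₁ ih =>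
      rintro (_ | ⟨b, l₂⟩) hl
      · rw [List.map_cons, List.prod_cons] at hl
        exact absurd hl (hne a _ a.2 (hmem l₁))
      · rw [List.map_cons, List.prod_cons, List.map_cons, List.prod_cons] at hl
        by_cases hab : a = b
        · subst hab
          rw [ih l₂ (mul_left_cancel hl)]
        · exfalso
          -- The common endpoint follows both `a p` and `b p` up to `α + δ`, against the margin `α +
          -- 150 δ`.
          have h1 := (hU.dist_prod h hδ _ (hmem l₁) a a.2).2
          have h2 := (hU.dist_prod h hδ _ (hmem l₂) b b.2).2
          rw [← hl, gromovProduct_comm] at h2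
          have h3 := hU.product_lt a a.2 b b.2 (fun h => hab (Subtype.ext h))
          have h4 := h.le_gromovProduct
            (c := min (dist ((a : G) • p) p) (dist ((b : G) • p) p) - α - δ)
            (le_trans (by linarith [min_le_left (dist ((a : G) • p) p) (dist ((b : G) • p) p)]) h1)
            (le_trans (by linarith [min_le_right (dist ((a : G) • p) p) (dist ((b : G) • p) p)]) h2)
          linarith
  intro l₁ l₂ hl
  apply FreeMonoid.toList.injective
  apply key
  simpa [FreeMonoid.lift_apply] using hl

end Action

/-! ### Almost minimizers of the total displacement -/

section Energy

variable {G X : Type*} [Group G] [MetricSpace X] [MulAction G X]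

theorem dist_le_energyAt (U : Finset G) (x : X) {u : G} (hu : u ∈ U) :
    dist (u • x) x ≤ energyAt U x :=
  le_ciSup (f := fun u : U => dist ((u : G) • x) x) (Set.finite_range _).bddAbove ⟨u, hu⟩

theorem energy_le_energyAt (U : Finset G) (x : X) : energy X U ≤ energyAt U x :=
  ciInf_le ⟨0, by rintro _ ⟨y, rfl⟩; exact Real.iSup_nonneg fun _ => dist_nonneg⟩ x

theorem exists_energy_le_dist {U : Finset G} (hU : U.Nonempty) (x : X) :
    ∃ v ∈ U, energy X U ≤ dist (v • x) x := by
  have : Nonempty U := hU.to_subtype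
  obtain ⟨v, hv⟩ := exists_eq_ciSup_of_finite (f := fun u : U => dist ((u : G) • x) x)
  exact ⟨v, v.2, (energy_le_energyAt U x).trans hv.ge⟩

/-- A point that almost minimizes the total displacement of `U`. -/
theorem exists_almost_minimizer (U : Finset G) (hU : U.Nonempty) {δ : ℝ} (hδ : 0 < δ)
    (hE : 0 < energy X U) :
    ∃ p : X, (∀ q : X, ∑ u ∈ U, dist (u • p) p ≤ ∑ u ∈ U, dist (u • q) q + δ * U.card) ∧
      ∑ u ∈ U, dist (u • p) p ≤ (energy X U + 2 * δ) * U.card := by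
  -- The infimum over an empty space is `0` by convention.
  have : Nonempty X := by
    by_contra h
    rw [not_nonempty_iff] at h
    simp [energy, Real.iInf_of_isEmpty] at hE
  have hU' : (0 : ℝ) < U.card := by exact_mod_cast hU.card_pos
  have hb : BddBelow (Set.range fun x : X => ∑ u ∈ U, dist (u • x) x) :=
    ⟨0, by rintro _ ⟨y, rfl⟩; exact Finset.sum_nonneg fun _ _ => dist_nonneg⟩
  obtain ⟨p, hp⟩ := exists_lt_of_ciInf_lt
    (lt_add_of_pos_right (⨅ x : X, ∑ u ∈ U, dist (u • x) x) (mul_pos hδ hU'))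
  have hmin : ∀ q : X, ∑ u ∈ U, dist (u • p) p ≤ ∑ u ∈ U, dist (u • q) q + δ * U.card :=
    fun q => hp.le.trans (add_le_add_left (ciInf_le hb q) _)
  refine ⟨p, hmin, ?_⟩
  obtain ⟨x, hx⟩ := exists_lt_of_ciInf_lt (lt_add_of_pos_right (energy X U) hδ)
  have h1 : ∑ u ∈ U, dist (u • x) x ≤ U.card • (energy X U + δ) :=
    Finset.sum_le_card_nsmul _ _ _ fun u hu => (dist_le_energyAt U x hu).trans hx.le
  rw [nsmul_eq_mul] at h1
  linarith [hmin x]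

variable [IsIsometricSMul G X]

/-- If the orbit segments of many elements leave and enter `p` in the direction of `y`, then the
total displacement decreases when `p` is moved towards `y`. -/
theorem card_le_of_almost_minimizer {δ s : ℝ} (h : IsHyperbolic X δ) (hδ : 0 < δ) (hs : 0 ≤ s)
    {p q y : X} (hq : dist p q = s) (hqy : dist q y ≤ dist p y - s + δ) (U B N : Finset G)
    (hBU : B ⊆ U) (hNU : N ⊆ U)
    (hmin : ∑ u ∈ U, dist (u • p) p ≤ ∑ u ∈ U, dist (u • q) q + δ * U.card)
    (hB : ∀ u ∈ B, s ≤ gromovProduct (u⁻¹ • p) y p ∧ s ≤ gromovProduct (u • p) y p ∧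
      2 * s ≤ dist (u • p) p)
    (hN : ∀ u ∈ U, u ∉ N → s ≤ gromovProduct (u⁻¹ • p) y p ∨ s ≤ gromovProduct (u • p) y p) :
    2 * s * B.card ≤ 2 * s * N.card + 11 * δ * U.card := by
  classical
  have hin : ∀ u : G, s ≤ gromovProduct (u⁻¹ • p) y p →
      dist (u • q) p ≤ dist (u • p) p - s + 4 * δ := by
    intro u hu
    have h1 := h.dist_le_sub hδ hq hqy hu
    rwa [dist_inv_smul_self, ← dist_smul u, smul_inv_smul, dist_comm p] at h1
  -- Each end of `[p, u p]` gains `s` if it points towards `y` and loses at most `s` otherwise.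
  have hpt : ∀ u ∈ U, dist (u • q) q ≤ dist (u • p) p + 10 * δ +
      (if u ∈ N then 2 * s else 0) - (if u ∈ B then 2 * s else 0) := by
    intro u hu
    have hpq : dist (u • p) (u • q) = s := by rw [dist_smul, hq]
    by_cases huB : u ∈ B
    · obtain ⟨h1, h2, h3⟩ := hB u huB
      have h4 := hin u h1
      have h5 := h.dist_le_sub hδ hq hqy h2
      have h6 := h.dist_add_dist_le (u • q) p q (u • p)
      rw [hq, dist_comm (u • q) (u • p), hpq, dist_comm p (u • p), dist_comm q (u • p)] at h6
      have h7 : (0 : ℝ) ≤ if u ∈ N then 2 * s else 0 := by split_ifs <;> linarith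
      rw [if_pos huB]
      -- The second case is where `2 s ≤ |u p - p|` is needed.
      rcases max_cases (dist (u • q) p + dist (u • p) q) (s + s) with h8 | h8 <;> linarith
    · rw [if_neg huB]
      by_cases huN : u ∈ N
      · rw [if_pos huN]
        have := dist_triangle4 (u • q) (u • p) p q
        rw [dist_comm (u • q) (u • p), hpq, hq] at this
        linarith
      · rw [if_neg huN]
        rcases hN u hu huN with h1 | h1
        · have h4 := hin u h1
          have := dist_triangle (u • q) p q
          linarith
        · have h5 := h.dist_le_sub hδ hq hqy h1
          have := dist_triangle (u • q) (u • p) q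
          rw [dist_comm (u • q) (u • p), hpq] at this
          linarith
  have hsum := Finset.sum_le_sum hpt
  rw [Finset.sum_sub_distrib, Finset.sum_add_distrib, Finset.sum_add_distrib, ← Finset.sum_filter,
    ← Finset.sum_filter, Finset.filter_mem_eq_inter, Finset.filter_mem_eq_inter,
    Finset.inter_eq_right.2 hBU, Finset.inter_eq_right.2 hNU] at hsum
  simp only [Finset.sum_const, nsmul_eq_mul] at hsum
  linarith

/-- At an almost minimizer of the total displacement, some element of a large set `S` can be
composed without cancellation, on both sides, with a proportion of the elements of `S`. -/
theorem exists_compatible {δ : ℝ} (hX : IsLengthSpace X) (h : IsHyperbolic X δ) (hδ : 0 < δ) {p : X}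
    (U S : Finset G) (hSU : S ⊆ U) (hU : U.Nonempty)
    (hmin : ∀ q : X, ∑ u ∈ U, dist (u • p) p ≤ ∑ u ∈ U, dist (u • q) q + δ * U.card)
    (hS : 17 / 20 * (U.card : ℝ) ≤ S.card) (hSd : ∀ u ∈ S, 1000 * δ < dist (u • p) p) :
    ∃ v ∈ S, ∃ T ⊆ S, (U.card : ℝ) ≤ 20 * T.card ∧ ∀ u ∈ T,
      gromovProduct (u⁻¹ • p) (v • p) p ≤ 202 * δ ∧
      gromovProduct (v⁻¹ • p) (u • p) p ≤ 202 * δ := by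
  classical
  by_contra! hcon
  have hUpos : (0 : ℝ) < U.card := by exact_mod_cast hU.card_pos
  have hsmall : ∀ v ∈ S, ∀ T ⊆ S, (∀ u ∈ T, gromovProduct (u⁻¹ • p) (v • p) p ≤ 202 * δ ∧
      gromovProduct (v⁻¹ • p) (u • p) p ≤ 202 * δ) → 20 * (T.card : ℝ) < U.card := by
    intro v hv T hT hT'
    by_contra! hc
    obtain ⟨u, hu, hu'⟩ := hcon v hv T hT hc
    exact absurd (hT' u hu).2 (not_le.2 (hu' (hT' u hu).1))
  have hSne : S.Nonempty := by
    rw [← Finset.card_pos, ← Nat.cast_pos (α := ℝ)]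
    linarith
  let P : G → G → Prop := fun u v => 202 * δ < gromovProduct (u⁻¹ • p) (v • p) p
  -- Over all pairs, the two kinds of cancellation are equally frequent, so some `v₀` meets the
  -- first kind for at least `2/5` of `U`.
  have hdc : ∑ v ∈ S, ((S.filter fun u => P u v).card : ℝ) =
      ∑ v ∈ S, ((S.filter fun u => P v u).card : ℝ) := by
    exact_mod_cast (Finset.sum_card_bipartiteAbove_eq_sum_card_bipartiteBelow (s := S) (t := S)
      P).symm
  have hsumS : ∑ v ∈ S, ((S.card : ℝ) - U.card / 20) ≤
      ∑ v ∈ S, 2 * ((S.filter fun u => P u v).card : ℝ) := by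
    have : ∀ v ∈ S, (S.card : ℝ) - U.card / 20 ≤
        ((S.filter fun u => P u v).card : ℝ) + (S.filter fun u => P v u).card := by
      intro v hv
      have h1 := hsmall v hv (S.filter fun u => ¬ P u v ∧ ¬ P v u) (Finset.filter_subset _ _)
        (fun u hu => by simpa [P] using (Finset.mem_filter.1 hu).2)
      have h2 : S ⊆ (S.filter fun u => ¬ P u v ∧ ¬ P v u) ∪
          ((S.filter fun u => P u v) ∪ (S.filter fun u => P v u)) := by
        intro u hu
        simp only [Finset.mem_union, Finset.mem_filter, hu, true_and]
        tauto
      have h3 : (S.card : ℝ) ≤ (S.filter fun u => ¬ P u v ∧ ¬ P v u).card +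
          ((S.filter fun u => P u v).card + (S.filter fun u => P v u).card) := by
        exact_mod_cast (Finset.card_le_card h2).trans ((Finset.card_union_le _ _).trans
          (Nat.add_le_add_left (Finset.card_union_le _ _) _))
      linarith
    refine (Finset.sum_le_sum this).trans (le_of_eq ?_)
    rw [Finset.sum_add_distrib, ← hdc, ← Finset.mul_sum]
    ring
  obtain ⟨v₀, hv₀, hF⟩ := Finset.exists_le_of_sum_le hSne hsumS
  set F := S.filter fun u => P u v₀ with hFdef
  have hFS : F ⊆ S := Finset.filter_subset _ _
  have hFP : ∀ u ∈ F, 202 * δ < gromovProduct (u⁻¹ • p) (v₀ • p) p := fun u hu =>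
    (Finset.mem_filter.1 hu).2
  set y := v₀ • p
  set B := F.filter fun u => 201 * δ ≤ gromovProduct (u • p) y p with hBdef
  set C := F.filter fun u => ¬ 201 * δ ≤ gromovProduct (u • p) y p with hCdef
  have hBF : B ⊆ F := Finset.filter_subset _ _
  have hBC : (B.card : ℝ) + C.card = F.card := by
    exact_mod_cast Finset.card_filter_add_card_filter_not (s := F)
      (fun u => 201 * δ ≤ gromovProduct (u • p) y p)
  have hBo : ∀ u ∈ B, 201 * δ ≤ gromovProduct (u • p) y p := fun u hu =>
    (Finset.mem_filter.1 hu).2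
  have hC : 20 * (C.card : ℝ) < U.card := by
    rcases C.eq_empty_or_nonempty with hC | ⟨v, hv⟩
    · simpa [hC] using hU
    -- In `C`, every `a⁻¹ p` points towards `y` and no `b p` does. The thresholds 202, 201, 200
    -- leave one `δ` per use of hyperbolicity.
    have hpair : ∀ a ∈ C, ∀ b ∈ C, gromovProduct (a⁻¹ • p) (b • p) p ≤ 202 * δ := by
      intro a ha b hb
      obtain ⟨ha, -⟩ := Finset.mem_filter.1 ha
      obtain ⟨-, hb⟩ := Finset.mem_filter.1 hb
      by_contra! hab
      rw [gromovProduct_comm] at hab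
      have := h.le_gromovProduct hab.le (hFP a ha).le
      linarith
    exact hsmall v (hFS (Finset.mem_filter.1 hv).1) C ((Finset.filter_subset _ _).trans hFS)
      fun u hu => ⟨hpair u hu v hv, hpair v hv u hu⟩
  obtain ⟨v, hv⟩ : B.Nonempty := by
    rw [← Finset.card_pos, ← Nat.cast_pos (α := ℝ)]
    linarith
  -- Both ends of `v ∈ B` point towards `y`, so elements with neither end in that direction are
  -- compatible with `v`.
  have hN : 20 * ((S.filter fun u => gromovProduct (u⁻¹ • p) y p < 200 * δ ∧
      gromovProduct (u • p) y p < 200 * δ).card : ℝ) < U.card := by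
    refine hsmall v (hFS (hBF hv)) _ (Finset.filter_subset _ _) fun u hu => ?_
    obtain ⟨-, hi, ho⟩ := Finset.mem_filter.1 hu
    constructor
    · by_contra! hc
      have := h.le_gromovProduct (c := 201 * δ) (by linarith) (hBo v hv) (x := u⁻¹ • p)
      linarith
    · by_contra! hc
      rw [gromovProduct_comm] at hc
      have := h.le_gromovProduct hc.le (hFP v (hBF hv)).le
      linarith
  obtain ⟨q, hq, hqy⟩ := hX.exists_between p y (s := 200 * δ) (by positivity)
    (by rw [dist_comm]; linarith [hSd v₀ hv₀]) hδ
  have hmove := card_le_of_almost_minimizer h hδ (by positivity) hq hqy U B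
    ((U \ S) ∪ (S.filter fun u => gromovProduct (u⁻¹ • p) y p < 200 * δ ∧
      gromovProduct (u • p) y p < 200 * δ))
    ((hBF.trans hFS).trans hSU)
    (Finset.union_subset Finset.sdiff_subset ((Finset.filter_subset _ _).trans hSU)) (hmin q)
    (fun u hu => ⟨by linarith [hFP u (hBF hu)], by linarith [hBo u hu],
      by linarith [hSd u (hFS (hBF hu))]⟩)
    (fun u hu hu' => by
      simp only [Finset.mem_union, Finset.mem_sdiff, Finset.mem_filter, not_or, not_and, not_lt,
        hu, true_and, not_not] at hu'
      by_contra! hc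
      exact absurd (hu'.2 hu'.1 hc.1) (not_le.2 hc.2))
  have hcup : ((((U \ S) ∪ (S.filter fun u => gromovProduct (u⁻¹ • p) y p < 200 * δ ∧
      gromovProduct (u • p) y p < 200 * δ)).card : ℕ) : ℝ) ≤ (U \ S).card +
      (S.filter fun u => gromovProduct (u⁻¹ • p) y p < 200 * δ ∧
      gromovProduct (u • p) y p < 200 * δ).card := by
    exact_mod_cast Finset.card_union_le _ _
  have hsd : ((U \ S).card : ℝ) + S.card = U.card := by
    exact_mod_cast Finset.card_sdiff_add_card_eq_card hSU
  -- The exceptional set is at most `3/20 + 1/20` of `U`, whereas `B` exceeds `2/5 - 1/20`.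
  have h1 : (B.card : ℝ) ≤ 29 / 100 * U.card := by
    have : (400 * δ) * (B.card : ℝ) ≤ (400 * δ) * (((U \ S) ∪ (S.filter fun u =>
        gromovProduct (u⁻¹ • p) y p < 200 * δ ∧ gromovProduct (u • p) y p < 200 * δ)).card +
        11 / 400 * U.card) := by linarith
    have := le_of_mul_le_mul_left this (by positivity)
    linarith
  linarith

end Energy

/-! ### Large and small displacements -/

section Alternatives

variable {G X : Type*} [Group G] [MetricSpace X] [MulAction G X] [IsIsometricSMul G X]

/-- Strongly reduced sets when few elements of `U` have small displacement. -/
theorem exists_isStronglyReduced_of_diffuse {δ κ N L : ℝ} (hacyl : IsAcylindrical G X δ N κ)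
    (hδ : 0 < δ) (hκ : 50 * 10 ^ 3 * δ ≤ κ) (hL : 0 ≤ L) (hX : IsLengthSpace X)
    (h : IsHyperbolic X δ) {p : X} (U S : Finset G) (hSU : S ⊆ U) (hU : U.Nonempty)
    (hmin : ∀ q : X, ∑ u ∈ U, dist (u • p) p ≤ ∑ u ∈ U, dist (u • q) q + δ * U.card)
    (hS : 17 / 20 * (U.card : ℝ) ≤ S.card) (hSd : ∀ u ∈ S, 2 * κ < dist (u • p) p)
    (hSL : ∀ u ∈ S, dist (u • p) p ≤ L) :
    ∃ v ∈ U, ∃ W : Finset G, (W : Set G) ⊆ (fun u : G => u * v) '' (U : Set G) ∧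
      IsStronglyReduced δ (204 * δ) p W ∧
      (U.card : ℝ) ≤ 20 * ((2 * L / δ + 1) * (N * W.card)) := by
  obtain ⟨v, hv, T, hTS, hTU, hT⟩ := exists_compatible hX h hδ U S hSU hU hmin hS
    (fun u hu => by linarith [hSd u hu])
  have hlen : ∀ u ∈ T, dist (u • p) p + dist (v • p) p - 404 * δ ≤ dist ((u * v) • p) p := by
    intro u hu
    have h1 := gromovProduct_mul_smul_add u v p
    have h2 := (hT u hu).1
    unfold gromovProduct at h1 h2
    rw [dist_inv_smul_self] at h1 h2
    have h3 : dist (u • p) ((u * v) • p) = dist (v • p) p := by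
      rw [mul_smul, dist_smul, dist_comm]
    linarith
  obtain ⟨W, hWT, hW, hc⟩ := exists_isStronglyReduced hacyl hδ (by linarith) hX h (p := p) (v := v)
    (D := 202 * δ) (α := 204 * δ) (lo := κ) (M := 2 * L) (by positivity) (by positivity)
    (by positivity) (by linarith) (by linarith [hSd v hv]) T (fun u hu => (hT u hu).1)
    (fun u hu => ⟨by linarith [hlen u hu, hSd u (hTS hu), hSd v hv], by
      have h1 := dist_triangle ((u * v) • p) (u • p) p
      rw [mul_smul, dist_smul, ← mul_smul] at h1
      linarith [hSL u (hTS hu), hSL v hv]⟩)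
    -- `(u₁ v)⁻¹ p` follows `v⁻¹ p` and `u₂ v p` follows `u₂ p`, so the bound `202 δ` on `(v⁻¹ p, u₂
    -- p)_p` becomes `204 δ`.
    (fun u₁ h₁ u₂ h₂ => by
      by_contra! hc
      have e₁ : dist (v • p) p - 202 * δ ≤ gromovProduct (v⁻¹ • p) ((u₁ * v)⁻¹ • p) p := by
        have := gromovProduct_mul_smul_add v⁻¹ u₁⁻¹ p
        rw [inv_inv, gromovProduct_comm (v • p), ← mul_inv_rev, dist_inv_smul_self] at this
        linarith [(hT u₁ h₁).1]
      have e₂ := gromovProduct_mul_smul_add u₂ v p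
      rw [gromovProduct_comm (u₂ • p)] at e₂
      have f₁ := h (v⁻¹ • p) ((u₁ * v)⁻¹ • p) ((u₂ * v) • p) p
      have f₂ := h (v⁻¹ • p) ((u₂ * v) • p) (u₂ • p) p
      have f₃ : 204 * δ < min (gromovProduct (v⁻¹ • p) ((u₁ * v)⁻¹ • p) p)
          (gromovProduct ((u₁ * v)⁻¹ • p) ((u₂ * v) • p) p) :=
        lt_min (by linarith [hSd v hv]) hc
      have f₄ : 203 * δ < min (gromovProduct (v⁻¹ • p) ((u₂ * v) • p) p)
          (gromovProduct ((u₂ * v) • p) (u₂ • p) p) :=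
        lt_min (by linarith) (by linarith [hSd u₂ (hTS h₂), (hT u₂ h₂).1])
      linarith [(hT u₂ h₂).2])
  refine ⟨v, hSU hv, W, hWT.trans (Set.image_mono (Finset.coe_subset.2 (hTS.trans hSU))), hW, ?_⟩
  linarith

/-- Strongly reduced sets when many elements of `U` have small displacement. -/
theorem exists_isStronglyReduced_of_concentrated {δ κ N : ℝ} (hacyl : IsAcylindrical G X δ N κ)
    (hδ : 0 < δ) (hκ : 50 * 10 ^ 3 * δ ≤ κ) (hX : IsLengthSpace X)
    (h : IsHyperbolic X δ) {p : X} {v : G} (hv : 100 * κ < dist (v • p) p) (C : Finset G)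
    (hC : ∀ u ∈ C, dist (u • p) p ≤ 2 * κ) :
    ∃ W : Finset G, (W : Set G) ⊆ (fun u : G => u * v) '' (C : Set G) ∧
      IsStronglyReduced δ (7 * κ) p W ∧
      (C.card : ℝ) ≤ (4 * κ / δ + 1) * N + (4 * κ / δ + 1) * (N * W.card) := by
  classical
  have hκ0 : 0 < κ := by linarith
  have hD : ∀ u ∈ C, gromovProduct (u⁻¹ • p) (v • p) p ≤ 2 * κ := by
    intro u hu
    have := dist_triangle (v • p) (u⁻¹ • p) p
    unfold gromovProduct
    rw [dist_comm (v • p) (u⁻¹ • p)] at this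
    have h1 := hC u hu
    rw [← dist_inv_smul_self] at h1
    linarith
  have hlen : ∀ u ∈ C, dist (v • p) p - 2 * κ ≤ dist ((u * v) • p) p ∧
      dist ((u * v) • p) p ≤ dist (v • p) p - 2 * κ + 4 * κ := by
    intro u hu
    have h3 : dist (u • p) ((u * v) • p) = dist (v • p) p := by
      rw [mul_smul, dist_smul, dist_comm]
    have h1 := dist_triangle ((u * v) • p) (u • p) p
    rw [dist_comm _ (u • p)] at h1
    have := hC u hu
    constructor
    · have := dist_triangle (u • p) p ((u * v) • p)
      rw [dist_comm p] at this
      linarith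
    · linarith
  -- In `E` all `u v p` point towards `v⁻¹ p`, hence share a beginning of length about `6 κ`;
  -- acylindricity makes `E` small. Outside `E`, `u v` has bounded cyclic cancellation.
  set E := C.filter fun u => 6 * κ < gromovProduct ((u * v) • p) (v⁻¹ • p) p with hEdef
  have hEC : E ⊆ C := Finset.filter_subset _ _
  have hE : (E.card : ℝ) ≤ (4 * κ / δ + 1) * N := by
    obtain ⟨a, T, hTE, hT, hc⟩ := exists_interval_card E (fun u => dist ((u * v) • p) p) hδ
      (by linarith) (fun u hu => hlen u (hEC hu))
    refine hc.trans ?_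
    have : 0 ≤ 4 * κ / δ + 1 := by positivity
    refine mul_le_mul_of_nonneg_left ?_ this
    rcases T.eq_empty_or_nonempty with rfl | ⟨u₀, hu₀⟩
    · obtain ⟨-, hN⟩ := hacyl p (v • p) (by rw [dist_comm]; linarith)
      exact le_trans (by simp) hN
    · have ha := (hT u₀ hu₀).1
      have ha' := (hlen u₀ (hEC (hTE hu₀))).2
      refine hacyl.card_le hδ hX h (p := p) (v := v) (D := 2 * κ) (τ := 3 * κ) (a := a)
        (by linarith) hκ0.le (by linarith) (by linarith) T hu₀
        (fun u hu => hD u (hEC (hTE hu))) hT T subset_rfl fun u hu => ?_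
      have h1 := (Finset.mem_filter.1 (hTE hu₀)).2
      have h2 := (Finset.mem_filter.1 (hTE hu)).2
      rw [gromovProduct_comm] at h2
      have := h.le_gromovProduct h1.le h2.le
      linarith
  obtain ⟨W, hWT, hW, hc⟩ := exists_isStronglyReduced hacyl hδ hκ0.le hX h (p := p) (v := v)
    (D := 2 * κ) (α := 7 * κ) (lo := dist (v • p) p - 2 * κ) (M := 4 * κ) (by linarith)
    (by linarith) (by linarith) (by linarith) (by linarith) (C \ E)
    (fun u hu => hD u (Finset.sdiff_subset hu)) (fun u hu => hlen u (Finset.sdiff_subset hu))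
    (fun u₁ h₁ u₂ h₂ => by
      obtain ⟨h₁, -⟩ := Finset.mem_sdiff.1 h₁
      obtain ⟨h₂, h₂E⟩ := Finset.mem_sdiff.1 h₂
      have h₃ : gromovProduct ((u₂ * v) • p) (v⁻¹ • p) p ≤ 6 * κ := by
        by_contra! hc
        exact h₂E (Finset.mem_filter.2 ⟨h₂, hc⟩)
      by_contra! hc
      have e₁ : 7 * κ ≤ gromovProduct ((u₁ * v)⁻¹ • p) (v⁻¹ • p) p := by
        have := gromovProduct_mul_smul_add v⁻¹ u₁⁻¹ p
        rw [inv_inv, gromovProduct_comm (v • p), ← mul_inv_rev, dist_inv_smul_self,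
          gromovProduct_comm] at this
        linarith [hD u₁ h₁]
      rw [gromovProduct_comm] at hc
      have := h.le_gromovProduct hc.le e₁
      linarith)
  refine ⟨W, hWT.trans (Set.image_mono (Finset.coe_subset.2 Finset.sdiff_subset)), hW, ?_⟩
  have hsd : ((C \ E).card : ℝ) + E.card = C.card := by
    exact_mod_cast Finset.card_sdiff_add_card_eq_card hEC
  linarith

end Alternatives

end HypGroup

theorem theoremT {G X : Type*} [Group G] [MetricSpace X] [MulAction G X] [IsIsometricSMul G X]
    (δ κ N : ℝ) (hδ : 0 < δ) (hκ : 50 * 10 ^ 3 * δ ≤ κ) (hN : 0 < N)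
    (hlength : HypGroup.IsLengthSpace X) (hhyp : HypGroup.IsHyperbolic X δ)
    (hacyl : HypGroup.IsAcylindrical G X δ N κ) :
    (∀ U : Finset G, 100 * κ < HypGroup.energy X U →
      (U.card : ℝ) ≤ 400 * κ * N / δ ∨
      ∃ p : X, ∃ v ∈ U, ∃ W : Finset G, ∃ α : ℝ,
        (W : Set G) ⊆ (fun u : G => u * v) '' (U : Set G) ∧
        α ≤ 25 * κ ∧
        HypGroup.IsStronglyReduced δ α p W ∧
        1 / (10 ^ 6 * N) * (δ / HypGroup.energy X U) * (U.card : ℝ) ≤ (W.card : ℝ)) ∧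
    (∀ (p : X) (α : ℝ) (W : Finset G),
      HypGroup.IsStronglyReduced δ α p W → HypGroup.FreelyGenerates W) := by
  classical
  refine ⟨fun U hE => or_iff_not_imp_left.2 fun hcard => ?_,
    fun p α W hW => hW.freelyGenerates hhyp hδ⟩
  rw [not_le] at hcard
  have hκ0 : 0 < κ := by linarith
  have hU0 : (0 : ℝ) < U.card := lt_trans (by positivity) hcard
  have hU : U.Nonempty := Finset.card_pos.1 (by exact_mod_cast hU0)
  set ℓ := HypGroup.energy X U with hℓ
  have hℓ0 : 0 < ℓ := by linarith
  obtain ⟨p, hmin, hsum⟩ := HypGroup.exists_almost_minimizer U hU hδ hℓ0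
  have hgoal : ∀ w : ℝ, (U.card : ℝ) ≤ 10 ^ 6 * (ℓ / δ) * (N * w) →
      1 / (10 ^ 6 * N) * (δ / ℓ) * (U.card : ℝ) ≤ w := by
    intro w hw
    calc 1 / (10 ^ 6 * N) * (δ / ℓ) * (U.card : ℝ)
        ≤ 1 / (10 ^ 6 * N) * (δ / ℓ) * (10 ^ 6 * (ℓ / δ) * (N * w)) := by gcongr
      _ = w := by field_simp
  have hκδ : 1 ≤ κ / δ := by
    rw [le_div_iff₀ hδ]
    linarith
  have hℓκ : 100 * (κ / δ) ≤ ℓ / δ := by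
    rw [← mul_div_assoc]
    gcongr
  by_cases hC : (U.card : ℝ) ≤ 10 * (U.filter fun u => dist (u • p) p ≤ 2 * κ).card
  · obtain ⟨v, hvU, hv⟩ := HypGroup.exists_energy_le_dist hU p
    obtain ⟨W, hWU, hW, hc⟩ := HypGroup.exists_isStronglyReduced_of_concentrated hacyl hδ hκ
      hlength hhyp (hE.trans_le hv) (U.filter fun u => dist (u • p) p ≤ 2 * κ)
      (fun u hu => (Finset.mem_filter.1 hu).2)
    refine ⟨p, v, hvU, W, 7 * κ,
      hWU.trans (Set.image_mono (Finset.coe_subset.2 (Finset.filter_subset _ _))), by linarith, hW,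
      hgoal _ ?_⟩
    have h1 : (4 * κ / δ + 1) * N ≤ 5 * (κ / δ) * N := by
      gcongr
      rw [mul_div_assoc]
      linarith
    have h2 : (4 * κ / δ + 1) * (N * W.card) ≤ ℓ / δ * (N * W.card) := by
      gcongr
      rw [mul_div_assoc]
      linarith
    -- As alternative 1 fails, the exceptional elements are fewer than `|U| / 80`, against `|U| /
    -- 10`.
    have h3 : 400 * κ * N / δ = 80 * (5 * (κ / δ) * N) := by ring
    have h4 : 0 ≤ ℓ / δ * (N * W.card) := by positivity
    rw [h3] at hcard
    linarith
  · rw [not_le] at hC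
    -- Markov's inequality: the mean displacement is at most `ℓ + 2 δ`, so at most `1/20` of `U`
    -- exceeds `L`.
    set L := 20 * (ℓ + 2 * δ) with hL
    have hlong : 20 * ((U.filter fun u => L < dist (u • p) p).card : ℝ) ≤ U.card := by
      have h1 : ((U.filter fun u => L < dist (u • p) p).card : ℝ) * L ≤
          ∑ u ∈ U, dist (u • p) p := by
        rw [← nsmul_eq_mul]
        exact (Finset.card_nsmul_le_sum _ _ _ fun u hu => (Finset.mem_filter.1 hu).2.le).trans
          (Finset.sum_le_sum_of_subset_of_nonneg (Finset.filter_subset _ _)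
            fun _ _ _ => dist_nonneg)
      have h2 := h1.trans hsum
      rw [hL] at h2
      refine le_of_mul_le_mul_left ?_ (by linarith : 0 < ℓ + 2 * δ)
      linarith
    set S := U.filter fun u => 2 * κ < dist (u • p) p ∧ dist (u • p) p ≤ L with hSdef
    have hS : (U.card : ℝ) ≤ (U.filter fun u => dist (u • p) p ≤ 2 * κ).card +
        (U.filter fun u => L < dist (u • p) p).card + S.card := by
      have : U ⊆ ((U.filter fun u => dist (u • p) p ≤ 2 * κ) ∪
          (U.filter fun u => L < dist (u • p) p)) ∪ S := by
        intro u hu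
        simp only [hSdef, Finset.mem_union, Finset.mem_filter, hu, true_and, ← not_lt]
        tauto
      exact_mod_cast (Finset.card_le_card this).trans ((Finset.card_union_le _ _).trans
        (Nat.add_le_add_right (Finset.card_union_le _ _) _))
    obtain ⟨v, hvU, W, hWU, hW, hc⟩ := HypGroup.exists_isStronglyReduced_of_diffuse hacyl hδ hκ
      (by linarith : 0 ≤ L) hlength hhyp U S (Finset.filter_subset _ _) hU hmin (by linarith)
      (fun u hu => (Finset.mem_filter.1 hu).2.1) (fun u hu => (Finset.mem_filter.1 hu).2.2)
    refine ⟨p, v, hvU, W, 204 * δ, hWU, by linarith, hW, hgoal _ (hc.trans ?_)⟩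
    have h1 : 2 * L / δ + 1 = 40 * (ℓ / δ) + 81 := by
      rw [hL]
      field_simp
      ring
    rw [h1]
    have h2 : (40 * (ℓ / δ) + 81) * (N * W.card) ≤ 200 * (ℓ / δ) * (N * W.card) := by
      gcongr
      linarith
    have h4 : 0 ≤ ℓ / δ * (N * W.card) := by positivity
    linarith
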